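/- Let $L,M>0$. Let $f:\mathbb R^d\to\mathbb R$ be $C^2$ with $L$-Lipschitz gradient and $M$-Lipschitz Hessian (spectral norm), and $f\ge \bar f$ everywhere. For tolerances $\epsilon_g,\epsilon_H>0$ and an upper bound $\alpha$ on negative-curvature step sizes, consider the following randomized algorithm started at $x_0$. At iteration $k=0,1,2,\dots$ it receives an approximate gradient $g_k$ and, * if $\|g_k\|>\epsilon_g$, sets $x_{k+1}=x_k-\frac1L g_k$; * otherwise it receives a symmetric approximate Hessian $H_k$ and a unit vector $\hat p_k$, and puts $\hat\lambda_k=\hat p_k^{T}H_k\hat p_k$. If $\hat\lambda_k<-\epsilon_H$, it sets $x_{k+1}=x_k+\frac{2\alpha_k}{M}\sigma_k\hat p_k$ with a step size $\alpha_k\in[\epsilon_H,\min(\alpha,|\hat\lambda_k|)]$ and a fair random sign $\sigma_k=\pm1$ independent of everything received or drawn before (including $g_k,H_k,\hat p_k$); if $\hat\lambda_k\ge-\epsilon_H$, it returns $x_k$ and stops. The quantities $g_k,H_k,\hat p_k$ may depend on the past and may be random. Assume that, almost surely, at all iterations up to termination, $$\|g_k-\nabla f(x_k)\|\le\tfrac13\max\{\epsilon_g,\|g_k\|\},\qquad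 \|H_k-\nabla^2f(x_k)\|\le\tfrac29\epsilon_H,\qquad |\hat\lambda_k-\lambda_{\min}(H_k)|\le\tfrac19\epsilon_H$$ (the last two whenever a Hessian is requested). Let $T$ be the iteration at which the algorithm returns ($T=\infty$ if it never does). Put $\Delta=f(x_0)-\bar f$ and, for $0<\delta<1$ and an integer $\eta\ge2$, $$C_\epsilon=\min\Big(\frac{\epsilon_g^2}{6L},\frac{2\epsilon_H^3}{9M^2}\Big),\quad B=1+\frac{18\alpha L}{M\epsilon_g},\quad C=2304\,\frac{M^2\alpha^2\epsilon_g^2}{\epsilon_H^6},$$ $$K=\max\Big\{C\log\tfrac1\delta,\ 4\eta C\Big(\frac{\Delta}{C_\epsilon}\Big)^{1/\eta},\ 4\eta^2C^{1+\frac1{\eta-1}}B^{\frac1{\eta-1}}\Big\},\qquad n=\frac{2\Delta}{C_\epsilon}+BK .$$ **Claim.** Let $\epsilon>0$, $\epsilon_g=\epsilon$, $\epsilon_H=\sqrt{\epsilon M}$, $\alpha=\epsilon_H$, $\alpha_k=\epsilon_H$ for all $k$, and $\eta=2$. 1. There is a constant $c>0$ depending only on $L$ and $M$ such that for all $\epsilon\in(0,1]$,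 all $\delta\in(0,1)$ and all values $\Delta\ge0$, $$C\le c,\qquad B\le c\,\epsilon^{-1/2},\qquad K\le c\,\big(1+\Delta+\log\tfrac1\delta\big)\,\epsilon^{-1},\qquad n\le c\,\big(1+\Delta+\log\tfrac1\delta\big)\,\epsilon^{-2}.$$ That is, $C=O(1)$, $B=O(\epsilon^{-1/2})$, $K=\tilde O(\epsilon^{-1})$ and $n=\tilde O(\epsilon^{-2})$. 2. For all $\epsilon>0$ and $\delta\in(0,1)$, the algorithm returns at some iteration $T<n$ with probability at least $1-\delta$. Moreover, if $\sqrt{\epsilon M}\le L$, this choice meets the requirements $\alpha\in[\epsilon_H,L]$ and, at every negative-curvature step, $\alpha_k\in[\epsilon_H,\min(\alpha,|\hat\lambda_k|)]$. -/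

import Mathlib

open MeasureTheory ProbabilityTheory
open scoped RealInnerProductSpace

namespace RandNC

/-- The space `ℝ^d` with the Euclidean norm. -/
abbrev Vec (d : ℕ) : Type := EuclideanSpace ℝ (Fin d)

/-- Linear operators on `ℝ^d` (that is, `d × d` matrices), with the spectral norm. -/
abbrev Op (d : ℕ) : Type := Vec d →L[ℝ] Vec d

/-- The Hessian of `f` at `x`, as the derivative of the gradient. -/
noncomputable def hessian {d : ℕ} (f : Vec d → ℝ) (x : Vec d) : Op d :=
  fderiv ℝ (gradient f) x

/-- The minimum eigenvalue of a symmetric operator. -/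
noncomputable def lambdaMin {d : ℕ} (A : Op d) : ℝ :=
  sInf {μ : ℝ | Module.End.HasEigenvalue (A : Vec d →ₗ[ℝ] Vec d) μ}

/-- `f` is twice continuously differentiable, its gradient is `L`-Lipschitz, its Hessian is
`M`-Lipschitz (for the spectral norm), and `f` is bounded below by `fbar`. -/
structure IsObjective {d : ℕ} (f : Vec d → ℝ) (L M fbar : ℝ) : Prop where
  contDiff : ContDiff ℝ 2 f
  gradient_lipschitz : ∀ x y, ‖gradient f x - gradient f y‖ ≤ L * ‖x - y‖
  hessian_lipschitz : ∀ x y, ‖hessian f x - hessian f y‖ ≤ M * ‖x - y‖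
  lower_bound : ∀ x, fbar ≤ f x

/-- The scalar inputs of the algorithm: the tolerances `ε_g`, `ε_H`, the Lipschitz constants
`L`, `M`, and the upper bound `α` on the negative curvature step sizes. -/
structure Params where
  epsG : ℝ
  epsH : ℝ
  L : ℝ
  M : ℝ
  alpha : ℝ

/-- Everything that the algorithm receives or draws along a run on the sample space `Ω`:
approximate gradients `g k`, approximate Hessians `H k`, approximate minimal eigenvectors
`p k`, step sizes `stepSize k` and random signs `sign k`. -/
structure RunData (d : ℕ) (Ω : Type*) where
  g : ℕ → Ω → Vec d
  H : ℕ → Ω → Op d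
  p : ℕ → Ω → Vec d
  stepSize : ℕ → Ω → ℝ
  sign : ℕ → Ω → ℝ

section Algorithm

variable {d : ℕ} {Ω : Type*}

/-- The approximate minimum eigenvalue `p_kᵀ H_k p_k`. -/
noncomputable def lambdaHat (R : RunData d Ω) (k : ℕ) (ω : Ω) : ℝ :=
  ⟪R.p k ω, R.H k ω (R.p k ω)⟫

/-- Condition for a gradient step at iteration `k`. -/
def GradStep (π : Params) (R : RunData d Ω) (k : ℕ) (ω : Ω) : Prop :=
  π.epsG < ‖R.g k ω‖

/-- Condition for a negative curvature step at iteration `k`. -/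
def NegCurvStep (π : Params) (R : RunData d Ω) (k : ℕ) (ω : Ω) : Prop :=
  ¬ GradStep π R k ω ∧ lambdaHat R k ω < -π.epsH

/-- Condition for returning `x_k` at iteration `k`. -/
def Returns (π : Params) (R : RunData d Ω) (k : ℕ) (ω : Ω) : Prop :=
  ¬ GradStep π R k ω ∧ ¬ NegCurvStep π R k ω

open Classical in
/-- The iterates `x_k` of the algorithm started at `x0`. Values after the first index at which
the algorithm returns are irrelevant. -/
noncomputable def iterate (π : Params) (R : RunData d Ω) (x0 : Vec d) : ℕ → Ω → Vec d
  | 0, _ => x0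
  | k + 1, ω =>
    if GradStep π R k ω then
      iterate π R x0 k ω - (1 / π.L) • R.g k ω
    else if NegCurvStep π R k ω then
      iterate π R x0 k ω + (2 * R.stepSize k ω / π.M * R.sign k ω) • R.p k ω
    else
      iterate π R x0 k ω

/-- The iteration at which the algorithm returns (`⊤` if it never does). -/
noncomputable def stopTime (π : Params) (R : RunData d Ω) (ω : Ω) : ℕ∞ :=
  ⨅ (k : ℕ) (_ : Returns π R k ω), (k : ℕ∞)

/-- Step sizes allowed by the algorithm: `α ∈ [ε_H, L]`, and `α_k ∈ [ε_H, min(α, |λ̂_k|)]` at every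
negative curvature step. -/
def AdmissibleSteps (π : Params) (R : RunData d Ω) : Prop :=
  π.alpha ∈ Set.Icc π.epsH π.L ∧
  ∀ k ω, NegCurvStep π R k ω →
    R.stepSize k ω ∈ Set.Icc π.epsH (min π.alpha |lambdaHat R k ω|)

/-- The information structure of a run: what is supplied at iteration `k` is known at time `k`
(it may depend on the past, and may be random), and `sign k` is a fair `±1` coin, independent of
the information at time `k`, that is known at time `k + 1`. -/
structure IsRandomized [mΩ : MeasurableSpace Ω] (P : Measure Ω) (ℱ : Filtration ℕ mΩ)
    (R : RunData d Ω) : Prop where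
  g_meas : ∀ k, StronglyMeasurable[ℱ k] (R.g k)
  H_meas : ∀ k, StronglyMeasurable[ℱ k] (R.H k)
  p_meas : ∀ k, StronglyMeasurable[ℱ k] (R.p k)
  stepSize_meas : ∀ k, StronglyMeasurable[ℱ k] (R.stepSize k)
  sign_meas : ∀ k, StronglyMeasurable[ℱ (k + 1)] (R.sign k)
  sign_one : ∀ k, P {ω | R.sign k ω = 1} = 1 / 2
  sign_neg_one : ∀ k, P {ω | R.sign k ω = -1} = 1 / 2
  sign_indep : ∀ k, Indep (MeasurableSpace.comap (R.sign k) inferInstance) (ℱ k) P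

/-- Accuracy of the gradients at all iterations `k` up to termination:
`‖g_k - ∇f(x_k)‖ ≤ (1/3) max(ε_g, ‖g_k‖)`. -/
def AccurateGradients (π : Params) (R : RunData d Ω) (f : Vec d → ℝ) (x0 : Vec d) (ω : Ω) :
    Prop :=
  ∀ k : ℕ, (k : ℕ∞) ≤ stopTime π R ω →
    ‖R.g k ω - gradient f (iterate π R x0 k ω)‖ ≤ 1 / 3 * max π.epsG ‖R.g k ω‖

/-- Accuracy of the (symmetric) approximate Hessians, `‖H_k - ∇²f(x_k)‖ ≤ (2/9) ε_H`, at all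
iterations up to termination at which a Hessian is requested. -/
def AccurateHessians (π : Params) (R : RunData d Ω) (f : Vec d → ℝ) (x0 : Vec d) (ω : Ω) :
    Prop :=
  ∀ k : ℕ, (k : ℕ∞) ≤ stopTime π R ω → ¬ GradStep π R k ω →
    (R.H k ω : Vec d →ₗ[ℝ] Vec d).IsSymmetric ∧
    ‖R.H k ω - hessian f (iterate π R x0 k ω)‖ ≤ 2 / 9 * π.epsH

/-- Accuracy of the approximate minimal eigenpairs, `‖p_k‖ = 1` and
`|λ̂_k - λ_min(H_k)| ≤ (1/9) ε_H`, at all iterations up to termination at which a Hessian is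
requested. -/
def AccurateEigenpairs (π : Params) (R : RunData d Ω) (ω : Ω) : Prop :=
  ∀ k : ℕ, (k : ℕ∞) ≤ stopTime π R ω → ¬ GradStep π R k ω →
    ‖R.p k ω‖ = 1 ∧ |lambdaHat R k ω - lambdaMin (R.H k ω)| ≤ 1 / 9 * π.epsH

end Algorithm

/-- `C_ε = min(ε_g² / (6L), 2 ε_H³ / (9 M²))`. -/
noncomputable def constCeps (π : Params) : ℝ :=
  min (π.epsG ^ 2 / (6 * π.L)) (2 * π.epsH ^ 3 / (9 * π.M ^ 2))

/-- `B = 1 + 18 α L / (M ε_g)`. -/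
noncomputable def constB (π : Params) : ℝ :=
  1 + 18 * π.alpha * π.L / (π.M * π.epsG)

/-- `C = 2304 M² α² ε_g² / ε_H⁶`. -/
noncomputable def constC (π : Params) : ℝ :=
  2304 * (π.M ^ 2 * π.alpha ^ 2 * π.epsG ^ 2 / π.epsH ^ 6)

/-- `K = max { C log(1/δ), 4 η C (Δ / C_ε)^(1/η), 4 η² C^(1 + 1/(η-1)) B^(1/(η-1)) }`, where `Δ`
stands for `f(x₀) - fbar`. -/
noncomputable def constK (π : Params) (η : ℕ) (Δ δ : ℝ) : ℝ :=
  max (constC π * Real.log (1 / δ))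
    (max (4 * (η : ℝ) * constC π * (Δ / constCeps π) ^ (1 / (η : ℝ)))
      (4 * (η : ℝ) ^ 2 * constC π ^ (1 + 1 / ((η : ℝ) - 1)) *
        constB π ^ (1 / ((η : ℝ) - 1))))

/-- The iteration bound `n = 2 Δ / C_ε + B K`. -/
noncomputable def iterBound (π : Params) (η : ℕ) (Δ δ : ℝ) : ℝ :=
  2 * (Δ / constCeps π) + constB π * constK π η Δ δ

/-- The parameters `ε_g = ε`, `ε_H = √(ε M)`, `α = ε_H`. -/
noncomputable def shortStepParams (L M ε : ℝ) : Params where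
  epsG := ε
  epsH := √(ε * M)
  L := L
  M := M
  alpha := √(ε * M)

end RandNC

namespace RandNC


/-! Write `D = 2 ε_H ^ 3 / (9 M ^ 2)`. A gradient step lowers `f` by at least `C_ε`. A negative
curvature step lowers it by `D`, up to a fair sign times a slope `b` known beforehand, with `|b| ≤
12 D` (`theta_mul_decrease_le`). With `θ = 1 / (144 D)` and `u_k = θ b_k`, the sum `Z` of `σ_k u_k -
u_k ^ 2 / 2` over `k < n` satisfies `E exp Z ≤ 1` (`lintegral_exp_sum_coin_le_one`), and each step
changes `θ f` by at most `-θ C_ε / 2` plus the increment of `Z`. As `f ≥ fbar`, a run still active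
after `n` steps has `Z ≥ n θ C_ε / 2 - θ Δ`, which is at least `log (1 / δ)` once `n` reaches the
iteration bound (`log_le_sum_of_not_returns`); Markov's inequality gives this event probability at
most `δ`. Of the three entries of `K`, only the logarithmic one is needed for this. The growth rates
follow by substituting `ε_H = √(ε M)`. -/

/-- A function with derivative at most that of a comparison function grows at most as much. -/
lemma sub_le_sub_of_hasDerivAt_le {φ ψ φ' ψ' : ℝ → ℝ} (hφ : ∀ t, HasDerivAt φ (φ' t) t)
    (hψ : ∀ t, HasDerivAt ψ (ψ' t) t) (h : ∀ t, 0 ≤ t → φ' t ≤ ψ' t) {t : ℝ} (ht : 0 ≤ t) :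
    φ t - φ 0 ≤ ψ t - ψ 0 := by
  have hd : ∀ t, HasDerivAt (fun t => ψ t - φ t) (ψ' t - φ' t) t := fun t => (hψ t).sub (hφ t)
  have hmono : MonotoneOn (fun t => ψ t - φ t) (Set.Ici 0) := by
    refine monotoneOn_of_deriv_nonneg (convex_Ici 0)
      (fun t _ => (hd t).continuousAt.continuousWithinAt)
      (fun t _ => (hd t).differentiableAt.differentiableWithinAt) fun t ht => ?_
    rw [interior_Ici] at ht
    rw [(hd t).deriv]
    exact sub_nonneg.2 (h t (le_of_lt ht))
  have := hmono (Set.mem_Ici.2 le_rfl) (Set.mem_Ici.2 ht) ht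
  simp only at this
  linarith

/-! ### Taylor upper bounds along a line. -/

section Taylor

variable {d : ℕ} {f : Vec d → ℝ} {L M fbar : ℝ}

lemma IsObjective.hasFDerivAt_gradient (hf : IsObjective f L M fbar) (x : Vec d) :
    HasFDerivAt (gradient f) (hessian f x) x := by
  have h1 : ContDiff ℝ 1 (fderiv ℝ f) := hf.contDiff.fderiv_right (by norm_num)
  have h2 : Differentiable ℝ (gradient f) :=
    ((InnerProductSpace.toDual ℝ (Vec d)).symm.toContinuousLinearEquiv.differentiable).comp
      (h1.differentiable (by norm_num))
  exact (h2 x).hasFDerivAt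

lemma IsObjective.continuous_gradient (hf : IsObjective f L M fbar) :
    Continuous (gradient f) :=
  continuous_iff_continuousAt.2 fun x => (hf.hasFDerivAt_gradient x).continuousAt

lemma hasDerivAt_line (x s : Vec d) (t : ℝ) : HasDerivAt (fun t : ℝ => x + t • s) s t := by
  simpa using ((hasDerivAt_id t).smul_const s).const_add x

lemma IsObjective.hasDerivAt_comp_line (hf : IsObjective f L M fbar) (x s : Vec d) (t : ℝ) :
    HasDerivAt (fun t : ℝ => f (x + t • s)) ⟪gradient f (x + t • s), s⟫ t := by
  have h : HasGradientAt f (gradient f (x + t • s)) (x + t • s) :=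
    (hf.contDiff.differentiable (by norm_num) _).hasGradientAt
  exact h.hasFDerivAt.comp_hasDerivAt t (hasDerivAt_line x s t)

lemma IsObjective.hasDerivAt_gradient_line (hf : IsObjective f L M fbar) (x s : Vec d) (t : ℝ) :
    HasDerivAt (fun t : ℝ => ⟪gradient f (x + t • s), s⟫) ⟪hessian f (x + t • s) s, s⟫ t := by
  simpa using ((hf.hasFDerivAt_gradient _).comp_hasDerivAt t (hasDerivAt_line x s t)).inner ℝ
    (hasDerivAt_const t s)

/-- The quadratic upper bound for functions with Lipschitz gradient. -/
lemma IsObjective.le_quadratic (hf : IsObjective f L M fbar) (x s : Vec d) :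
    f (x + s) ≤ f x + ⟪gradient f x, s⟫ + L / 2 * ‖s‖ ^ 2 := by
  have key := sub_le_sub_of_hasDerivAt_le (hf.hasDerivAt_comp_line x s)
    (ψ := fun t => t * ⟪gradient f x, s⟫ + L / 2 * ‖s‖ ^ 2 * t ^ 2)
    (ψ' := fun t => ⟪gradient f x, s⟫ + L * ‖s‖ ^ 2 * t) (fun t => by
      refine HasDerivAt.congr_deriv (((hasDerivAt_id t).mul_const _).add
        ((hasDerivAt_pow 2 t).const_mul (L / 2 * ‖s‖ ^ 2))) ?_
      norm_num [id]
      ring) (fun t ht => by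
      have h1 := real_inner_le_norm (gradient f (x + t • s) - gradient f x) s
      have h2 := mul_le_mul_of_nonneg_right (hf.gradient_lipschitz (x + t • s) x) (norm_nonneg s)
      rw [inner_sub_left] at h1
      rw [add_sub_cancel_left, norm_smul, Real.norm_of_nonneg ht] at h2
      linarith [mul_assoc L (t * ‖s‖) ‖s‖]) zero_le_one
  simp only [zero_smul, add_zero, one_smul, zero_mul, one_mul, one_pow, mul_one, ne_eq,
    OfNat.ofNat_ne_zero, not_false_eq_true, zero_pow, mul_zero, sub_zero] at key
  linarith

/-- The cubic upper bound for functions with Lipschitz Hessian. -/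
lemma IsObjective.le_cubic (hf : IsObjective f L M fbar) (x s : Vec d) :
    f (x + s) ≤ f x + ⟪gradient f x, s⟫ + 1 / 2 * ⟪hessian f x s, s⟫ + M / 6 * ‖s‖ ^ 3 := by
  -- The comparison is made twice: for the slope along the line, then for `f` itself.
  have hgrad : ∀ t : ℝ, 0 ≤ t → ⟪gradient f (x + t • s), s⟫ ≤
      ⟪gradient f x, s⟫ + t * ⟪hessian f x s, s⟫ + M / 2 * ‖s‖ ^ 3 * t ^ 2 := by
    intro t ht
    have key := sub_le_sub_of_hasDerivAt_le (hf.hasDerivAt_gradient_line x s)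
      (ψ := fun t => t * ⟪hessian f x s, s⟫ + M / 2 * ‖s‖ ^ 3 * t ^ 2)
      (ψ' := fun t => ⟪hessian f x s, s⟫ + M * ‖s‖ ^ 3 * t) (fun t => by
        refine HasDerivAt.congr_deriv (((hasDerivAt_id t).mul_const _).add
          ((hasDerivAt_pow 2 t).const_mul (M / 2 * ‖s‖ ^ 3))) ?_
        norm_num [id]
        ring) (fun t ht => by
        have h1 := real_inner_le_norm ((hessian f (x + t • s) - hessian f x) s) s
        have h2 := mul_le_mul_of_nonneg_right
          ((hessian f (x + t • s) - hessian f x).le_opNorm s) (norm_nonneg s)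
        have h3 := mul_le_mul_of_nonneg_right (hf.hessian_lipschitz (x + t • s) x)
          (mul_nonneg (norm_nonneg s) (norm_nonneg s))
        rw [_root_.sub_apply, inner_sub_left] at h1
        rw [add_sub_cancel_left, norm_smul, Real.norm_of_nonneg ht] at h3
        rw [_root_.sub_apply] at h2
        nlinarith) ht
    simp only [zero_smul, add_zero, zero_mul, ne_eq, OfNat.ofNat_ne_zero, not_false_eq_true,
      zero_pow, mul_zero, sub_zero] at key
    linarith
  have key := sub_le_sub_of_hasDerivAt_le (hf.hasDerivAt_comp_line x s)
    (ψ := fun t => t * ⟪gradient f x, s⟫ + 1 / 2 * ⟪hessian f x s, s⟫ * t ^ 2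
      + M / 6 * ‖s‖ ^ 3 * t ^ 3)
    (ψ' := fun t => ⟪gradient f x, s⟫ + t * ⟪hessian f x s, s⟫ + M / 2 * ‖s‖ ^ 3 * t ^ 2)
    (fun t => by
      refine HasDerivAt.congr_deriv ((((hasDerivAt_id t).mul_const _).add
        ((hasDerivAt_pow 2 t).const_mul (1 / 2 * ⟪hessian f x s, s⟫))).add
        ((hasDerivAt_pow 3 t).const_mul (M / 6 * ‖s‖ ^ 3))) ?_
      norm_num [id]
      ring) hgrad zero_le_one
  simp only [zero_smul, add_zero, one_smul, zero_mul, one_mul, one_pow, mul_one, ne_eq,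
    OfNat.ofNat_ne_zero, not_false_eq_true, zero_pow, mul_zero, sub_zero] at key
  linarith

end Taylor


/-! ### Exponential supermartingale of fair signs. -/

lemma half_exp_add_half_exp_neg_le (y : ℝ) :
    1 / 2 * Real.exp y + 1 / 2 * Real.exp (-y) ≤ Real.exp (y ^ 2 / 2) := by
  have := Real.cosh_le_exp_half_sq y
  rw [Real.cosh_eq] at this
  linarith

lemma ae_eq_one_or_eq_neg_one {Ω : Type*} {mΩ : MeasurableSpace Ω} {P : Measure Ω}
    [IsProbabilityMeasure P] {s : Ω → ℝ} (hs : Measurable s)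
    (h1 : P {ω | s ω = 1} = 1 / 2) (h2 : P {ω | s ω = -1} = 1 / 2) :
    ∀ᵐ ω ∂P, s ω = 1 ∨ s ω = -1 := by
  have hset : ∀ c : ℝ, MeasurableSet {ω | s ω = c} := fun c => hs (measurableSet_singleton c)
  have hu : P ({ω | s ω = 1} ∪ {ω | s ω = -1}) = 1 := by
    rw [measure_union _ (hset _), h1, h2, ENNReal.add_halves]
    rw [Set.disjoint_left]
    intro ω h h'
    simp only [Set.mem_ofPred_eq] at h h'
    linarith
  exact (prob_compl_eq_zero_iff ((hset 1).union (hset (-1)))).2 hu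

/-- One step of the exponential supermartingale of a fair sign times a predictable factor. -/
lemma lintegral_coin_mul_exp_le {Ω : Type*} {m mΩ : MeasurableSpace Ω} (hm : m ≤ mΩ)
    (P : Measure Ω) [IsProbabilityMeasure P] {s : Ω → ℝ} (hs : Measurable[mΩ] s)
    (h1 : P {ω | s ω = 1} = 1 / 2) (h2 : P {ω | s ω = -1} = 1 / 2)
    (hi : Indep (MeasurableSpace.comap s inferInstance) m P)
    {x y : Ω → ℝ} (hx : Measurable[m] x) (hy : Measurable[m] y) :
    ∫⁻ ω, ENNReal.ofReal (Real.exp (x ω + (s ω * y ω - y ω ^ 2 / 2))) ∂P ≤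
      ∫⁻ ω, ENNReal.ofReal (Real.exp (x ω)) ∂P := by
  have hset : ∀ c : ℝ, MeasurableSet[mΩ] {ω | s ω = c} := fun c => hs (measurableSet_singleton c)
  have hae := ae_eq_one_or_eq_neg_one hs h1 h2
  -- Independence factorises the integral on each of the two sign events, which cover almost all of
  -- the space.
  have hprod : ∀ c : ℝ, P {ω | s ω = c} = 1 / 2 → ∀ z : Ω → ENNReal, Measurable[m] z →
      ∫⁻ ω, {ω | s ω = c}.indicator 1 ω * z ω ∂P = 1 / 2 * ∫⁻ ω, z ω ∂P := by
    intro c hc z hz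
    have hle : MeasurableSpace.comap s inferInstance ≤ mΩ := hs.comap_le
    have hm1 : Measurable[MeasurableSpace.comap s inferInstance]
        ({ω | s ω = c}.indicator (1 : Ω → ENNReal)) :=
      by
      refine Measurable.indicator (m := MeasurableSpace.comap s inferInstance) ?_ ?_
      · exact @measurable_const _ _ _ (MeasurableSpace.comap s inferInstance) 1
      · exact ⟨{c}, measurableSet_singleton c, rfl⟩
    rw [lintegral_mul_eq_lintegral_mul_lintegral_of_independent_measurableSpace hle hm hi hm1 hz,
      lintegral_indicator_one (hset c), hc]
  have hz : ∀ c : ℝ, Measurable[m]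
      fun ω => ENNReal.ofReal (Real.exp (x ω + (c * y ω - y ω ^ 2 / 2))) := fun c => by fun_prop
  calc ∫⁻ ω, ENNReal.ofReal (Real.exp (x ω + (s ω * y ω - y ω ^ 2 / 2))) ∂P
      = ∫⁻ ω, ({ω | s ω = 1}.indicator 1 ω *
            ENNReal.ofReal (Real.exp (x ω + (1 * y ω - y ω ^ 2 / 2))) +
          {ω | s ω = -1}.indicator 1 ω *
            ENNReal.ofReal (Real.exp (x ω + (-1 * y ω - y ω ^ 2 / 2)))) ∂P := by
        refine lintegral_congr_ae ?_
        filter_upwards [hae] with ω h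
        rcases h with h | h <;> norm_num [Set.indicator, h]
    _ = 1 / 2 * ∫⁻ ω, ENNReal.ofReal (Real.exp (x ω + (1 * y ω - y ω ^ 2 / 2))) ∂P +
          1 / 2 * ∫⁻ ω, ENNReal.ofReal (Real.exp (x ω + (-1 * y ω - y ω ^ 2 / 2))) ∂P := by
        rw [lintegral_add_left, hprod 1 h1 _ (hz 1), hprod (-1) h2 _ (hz (-1))]
        exact ((measurable_one.indicator (hset 1))).mul ((hz 1).mono hm le_rfl)
    _ = ∫⁻ ω, (1 / 2 * ENNReal.ofReal (Real.exp (x ω + (1 * y ω - y ω ^ 2 / 2))) +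
          1 / 2 * ENNReal.ofReal (Real.exp (x ω + (-1 * y ω - y ω ^ 2 / 2)))) ∂P := by
        rw [lintegral_add_left (((hz 1).mono hm le_rfl).const_mul _),
          lintegral_const_mul _ ((hz 1).mono hm le_rfl),
          lintegral_const_mul _ ((hz (-1)).mono hm le_rfl)]
    _ ≤ ∫⁻ ω, ENNReal.ofReal (Real.exp (x ω)) ∂P := by
        refine lintegral_mono fun ω => ?_
        have hhalf : (1 / 2 : ENNReal) = ENNReal.ofReal (1 / 2) := by
          rw [ENNReal.ofReal_div_of_pos two_pos]; simp
        rw [hhalf, ← ENNReal.ofReal_mul (by norm_num), ← ENNReal.ofReal_mul (by norm_num),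
          ← ENNReal.ofReal_add (by positivity) (by positivity)]
        refine ENNReal.ofReal_le_ofReal ?_
        have h := mul_le_mul_of_nonneg_left (half_exp_add_half_exp_neg_le (y ω))
          (Real.exp_pos (x ω - y ω ^ 2 / 2)).le
        rw [← Real.exp_add, sub_add_cancel, mul_add, mul_left_comm, mul_left_comm _ (1 / 2 : ℝ),
          ← Real.exp_add, ← Real.exp_add] at h
        rwa [show x ω - y ω ^ 2 / 2 + y ω = x ω + (1 * y ω - y ω ^ 2 / 2) by ring,
          show x ω - y ω ^ 2 / 2 + -y ω = x ω + (-1 * y ω - y ω ^ 2 / 2) by ring] at h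

/-- The exponential supermartingale of a sum of fair signs with predictable factors. -/
lemma lintegral_exp_sum_coin_le_one {Ω : Type*} {mΩ : MeasurableSpace Ω}
    (P : Measure Ω) [IsProbabilityMeasure P] (ℱ : Filtration ℕ mΩ) {s u : ℕ → Ω → ℝ}
    (hs : ∀ k, StronglyMeasurable[ℱ (k + 1)] (s k))
    (h1 : ∀ k, P {ω | s k ω = 1} = 1 / 2) (h2 : ∀ k, P {ω | s k ω = -1} = 1 / 2)
    (hi : ∀ k, Indep (MeasurableSpace.comap (s k) inferInstance) (ℱ k) P)
    (hu : ∀ k, Measurable[ℱ k] (u k)) (n : ℕ) :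
    ∫⁻ ω, ENNReal.ofReal
      (Real.exp (∑ k ∈ Finset.range n, (s k ω * u k ω - u k ω ^ 2 / 2))) ∂P ≤ 1 := by
  induction n with
  | zero => simp
  | succ n ih =>
    simp only [Finset.sum_range_succ]
    refine (lintegral_coin_mul_exp_le (ℱ.le n) P ((hs n).measurable.mono (ℱ.le _) le_rfl)
      (h1 n) (h2 n) (hi n) ?_ (hu n)).trans ih
    -- The partial sum is known at time `n`: each of its signs is known at time `k + 1 ≤ n`.
    refine Finset.measurable_fun_sum _ fun k hk => ?_
    have hk := Finset.mem_range.1 hk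
    have hsk := (hs k).measurable.mono (ℱ.mono (Nat.succ_le_of_lt hk)) le_rfl
    have huk := (hu k).mono (ℱ.mono hk.le) le_rfl
    exact (hsk.mul huk).sub ((huk.pow_const 2).div_const 2)


/-! ### Size of the constants for short steps. -/

section Constants

variable {L M ε : ℝ}

lemma constC_shortStepParams (hM : 0 < M) (hε : 0 < ε) :
    constC (shortStepParams L M ε) = 2304 := by
  have h : √(ε * M) ^ 2 = ε * M := Real.sq_sqrt (by positivity)
  have h6 : √(ε * M) ^ 6 = (ε * M) ^ 3 := by
    rw [show 6 = 2 * 3 from rfl, pow_mul, h]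
  simp only [constC, shortStepParams, h, h6]
  field_simp

lemma constB_shortStepParams (hM : 0 < M) (hε : 0 < ε) :
    constB (shortStepParams L M ε) = 1 + 18 * L / √M * (1 / √ε) := by
  have h : √M ^ 2 = M := Real.sq_sqrt hM.le
  have h' : √ε ^ 2 = ε := Real.sq_sqrt hε.le
  have := Real.sqrt_pos.2 hM
  have := Real.sqrt_pos.2 hε
  simp only [constB, shortStepParams, Real.sqrt_mul hε.le]
  congr 1
  rw [div_mul_div_comm, div_eq_div_iff (by positivity) (by positivity)]
  nth_rewrite 3 [← h]
  nth_rewrite 3 [← h']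
  ring

/-- For `η = 2` the exponents are `1/2`, `2` and `1`; `18432 = 8 * 2304` and `84934656 = 16 * 2304 ^
2`. -/
lemma constK_shortStepParams (hM : 0 < M) (hε : 0 < ε) (Δ δ : ℝ) :
    constK (shortStepParams L M ε) 2 Δ δ = max (2304 * Real.log (1 / δ))
      (max (18432 * √(Δ / constCeps (shortStepParams L M ε)))
        (84934656 * constB (shortStepParams L M ε))) := by
  simp only [constK, constC_shortStepParams hM hε, Real.sqrt_eq_rpow]
  norm_num

lemma constB_shortStepParams_pos (hL : 0 < L) (hM : 0 < M) (hε : 0 < ε) :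
    0 < constB (shortStepParams L M ε) := by
  rw [constB_shortStepParams hM hε]
  positivity

lemma constCeps_shortStepParams_pos (hL : 0 < L) (hM : 0 < M) (hε : 0 < ε) :
    0 < constCeps (shortStepParams L M ε) := by
  simp only [constCeps, shortStepParams]
  have : 0 < √(ε * M) := Real.sqrt_pos.2 (by positivity)
  exact lt_min (by positivity) (by positivity)

lemma constK_shortStepParams_pos (hL : 0 < L) (hM : 0 < M) (hε : 0 < ε) (Δ δ : ℝ) :
    0 < constK (shortStepParams L M ε) 2 Δ δ := by
  rw [constK_shortStepParams hM hε]
  have := constB_shortStepParams_pos hL hM hε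
  exact lt_max_of_lt_right (lt_max_of_lt_right (by positivity))

lemma log_le_constK_shortStepParams (hM : 0 < M) (hε : 0 < ε) (Δ δ : ℝ) :
    2304 * Real.log (1 / δ) ≤ constK (shortStepParams L M ε) 2 Δ δ := by
  rw [constK_shortStepParams hM hε]
  exact le_max_left _ _

/-- The expected decrease of a negative curvature step is at most `8 C_ε B`. -/
lemma curvDecrease_le_constCeps_mul_constB (hL : 0 < L) (hM : 0 < M) (hε : 0 < ε) :
    2 * √(ε * M) ^ 3 / (9 * M ^ 2) ≤
      8 * constCeps (shortStepParams L M ε) * constB (shortStepParams L M ε) := by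
  have hB : 1 ≤ constB (shortStepParams L M ε) := by
    rw [constB_shortStepParams hM hε, le_add_iff_nonneg_right]
    positivity
  have hpos := constCeps_shortStepParams_pos hL hM hε
  have hs : 0 < √(ε * M) := Real.sqrt_pos.2 (by positivity)
  have h : √(ε * M) ^ 2 = ε * M := Real.sq_sqrt (by positivity)
  -- If `C_ε` is the gradient term, the summand `18 α L / (M ε_g)` of `B` converts it to the scale
  -- of `D`; otherwise `C_ε = D` and `B ≥ 1` suffices.
  rcases min_choice ((ε) ^ 2 / (6 * L)) (2 * √(ε * M) ^ 3 / (9 * M ^ 2)) with hc | hc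
  · have hC : constCeps (shortStepParams L M ε) = ε ^ 2 / (6 * L) := hc
    calc 2 * √(ε * M) ^ 3 / (9 * M ^ 2) = 2 / 9 * (√(ε * M) * ε / M) := by
          rw [pow_succ, h]; field_simp
      _ ≤ 24 * (√(ε * M) * ε / M) := by gcongr; norm_num
      _ = 8 * (ε ^ 2 / (6 * L)) * (18 * √(ε * M) * L / (M * ε)) := by field_simp; norm_num
      _ ≤ 8 * constCeps (shortStepParams L M ε) * constB (shortStepParams L M ε) := by
          rw [hC]
          refine mul_le_mul_of_nonneg_left ?_ (by positivity)
          simp only [constB, shortStepParams]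
          linarith
  · have hC : constCeps (shortStepParams L M ε) = 2 * √(ε * M) ^ 3 / (9 * M ^ 2) := hc
    rw [← hC]
    nlinarith

/-- The two terms of the minimum scale as `ε ^ 2` and `ε ^ (3/2)`; for `ε ≤ 1` the former is the
smaller power. -/
lemma exists_le_constCeps_shortStepParams (hL : 0 < L) (hM : 0 < M) :
    ∃ m : ℝ, 0 < m ∧ ∀ ε : ℝ, 0 < ε → ε ≤ 1 →
      m * ε ^ 2 ≤ constCeps (shortStepParams L M ε) := by
  have hsM := Real.sqrt_pos.2 hM
  refine ⟨min (1 / (6 * L)) (2 * √M ^ 3 / (9 * M ^ 2)), lt_min (by positivity) (by positivity),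
    fun ε hε hε1 => ?_⟩
  refine le_min ?_ ?_
  · calc _ ≤ 1 / (6 * L) * ε ^ 2 := by gcongr; exact min_le_left _ _
      _ = _ := by simp only [shortStepParams]; ring
  · calc _ ≤ 2 * √M ^ 3 / (9 * M ^ 2) * ε ^ 2 := by gcongr; exact min_le_right _ _
      _ ≤ 2 * √M ^ 3 / (9 * M ^ 2) * √ε ^ 3 := by
          gcongr
          have h1 : √ε ≤ 1 := Real.sqrt_le_one.2 hε1
          calc ε ^ 2 = √ε ^ 3 * √ε := by
                rw [← pow_succ, show 3 + 1 = 2 * 2 from rfl, pow_mul, Real.sq_sqrt hε.le]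
            _ ≤ √ε ^ 3 * 1 := by gcongr
            _ = √ε ^ 3 := mul_one _
      _ = _ := by simp only [shortStepParams, Real.sqrt_mul hε.le]; ring

/-- The orders of magnitude of the constants for short negative curvature steps. -/
theorem exists_constants_bound (hL : 0 < L) (hM : 0 < M) :
    ∃ c : ℝ, 0 < c ∧ ∀ ε : ℝ, 0 < ε → ε ≤ 1 →
      |constC (shortStepParams L M ε)| ≤ c ∧
      |constB (shortStepParams L M ε)| ≤ c * (1 / ε ^ (1 / 2 : ℝ)) ∧
      ∀ Δ δ : ℝ, 0 ≤ Δ → 0 < δ → δ < 1 →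
        |constK (shortStepParams L M ε) 2 Δ δ| ≤ c * (1 + Δ + Real.log (1 / δ)) * (1 / ε) ∧
        |iterBound (shortStepParams L M ε) 2 Δ δ|
          ≤ c * (1 + Δ + Real.log (1 / δ)) * (1 / ε ^ 2) := by
  obtain ⟨m, hm, hmC⟩ := exists_le_constCeps_shortStepParams hL hM
  have hsM := Real.sqrt_pos.2 hM
  set b : ℝ := 1 + 18 * L / √M with hb
  -- One summand per entry of `K`; `b` bounds `B √ε`.
  set k : ℝ := 2304 + 18432 * (1 + 1 / m) + 84934656 * b with hk
  have hb0 : 0 < b := by positivity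
  have hk0 : 0 < k := by positivity
  have hkb : 84934656 * b ≤ k := by
    have : 0 ≤ 1 / m := by positivity
    linarith
  have hk1 : 2304 ≤ k := by
    have : 0 ≤ 1 / m := by positivity
    linarith
  have hkm : 18432 * (1 + 1 / m) ≤ k := by linarith
  refine ⟨k + (2 / m + b * k), by positivity, fun ε hε hε1 => ?_⟩
  have hsε := Real.sqrt_pos.2 hε
  have hε1' : 1 ≤ 1 / ε := (one_le_div hε).2 hε1
  have hsε1 : 1 ≤ 1 / √ε := (one_le_div hsε).2 (Real.sqrt_le_one.2 hε1)
  have hss : 1 / √ε ≤ 1 / ε := by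
    have : (1 / √ε) * (1 / √ε) = 1 / ε := by
      rw [div_mul_div_comm, Real.mul_self_sqrt hε.le, one_mul]
    nlinarith
  have hεε : 1 / ε ^ 2 = 1 / ε * (1 / ε) := by rw [div_mul_div_comm]; ring
  have hB : constB (shortStepParams L M ε) ≤ b * (1 / √ε) := by
    rw [constB_shortStepParams hM hε, hb, add_mul, one_mul]
    linarith
  have hBpos := constB_shortStepParams_pos hL hM hε
  have hC := constC_shortStepParams (L := L) hM hε
  have hCe := constCeps_shortStepParams_pos hL hM hε
  have hrest : 0 ≤ 2 / m + b * k := by positivity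
  refine ⟨?_, ?_, fun Δ δ hΔ hδ hδ1 => ?_⟩
  · rw [hC, abs_of_pos (by norm_num)]
    linarith
  · rw [abs_of_pos hBpos, ← Real.sqrt_eq_rpow]
    refine hB.trans (mul_le_mul_of_nonneg_right ?_ (by positivity))
    linarith
  · have hlog : 0 ≤ Real.log (1 / δ) := Real.log_nonneg ((one_le_div hδ).2 hδ1.le)
    set S := 1 + Δ + Real.log (1 / δ) with hS
    have hS1 : 1 ≤ S := by linarith
    have hdiv : Δ / constCeps (shortStepParams L M ε) ≤ 1 / m * Δ * (1 / ε ^ 2) := by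
      calc Δ / constCeps (shortStepParams L M ε) ≤ Δ / (m * ε ^ 2) := by
            gcongr
            exact hmC ε hε hε1
        _ = _ := by field_simp
    have hKpos := constK_shortStepParams_pos hL hM hε Δ δ
    have hK : constK (shortStepParams L M ε) 2 Δ δ ≤ k * S * (1 / ε) := by
      rw [constK_shortStepParams hM hε]
      refine max_le ?_ (max_le ?_ ?_)
      · calc 2304 * Real.log (1 / δ) ≤ k * S := by gcongr; linarith
          _ ≤ k * S * (1 / ε) := le_mul_of_one_le_right (by positivity) hε1'
      · calc 18432 * √(Δ / constCeps (shortStepParams L M ε))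
            ≤ 18432 * ((1 + 1 / m) * S * (1 / ε)) := by
              gcongr
              refine Real.sqrt_le_iff.2 ⟨by positivity, hdiv.trans ?_⟩
              rw [hεε, show ((1 + 1 / m) * S * (1 / ε)) ^ 2 =
                (1 + 1 / m) ^ 2 * S ^ 2 * (1 / ε * (1 / ε)) by ring]
              -- The square root is removed by `1 / m ≤ (1 + 1 / m) ^ 2` and `Δ ≤ S ^ 2`.
              have h0 : 0 ≤ 1 / m := by positivity
              gcongr
              · nlinarith
              · nlinarith
          _ = 18432 * (1 + 1 / m) * (S * (1 / ε)) := by ring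
          _ ≤ k * (S * (1 / ε)) := by gcongr
          _ = k * S * (1 / ε) := by ring
      · calc 84934656 * constB (shortStepParams L M ε) ≤ 84934656 * (b * (1 / ε)) := by
              gcongr
              exact hB.trans (by gcongr)
          _ = 84934656 * b * 1 * (1 / ε) := by ring
          _ ≤ k * S * (1 / ε) := by gcongr
    refine ⟨?_, ?_⟩
    · rw [abs_of_pos hKpos]
      refine hK.trans ?_
      gcongr
      linarith
    · have hpos : 0 ≤ iterBound (shortStepParams L M ε) 2 Δ δ := by
        unfold iterBound
        positivity
      rw [abs_of_nonneg hpos]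
      -- The cruder `B ≤ b / ε` suffices here, since the term `Δ / C_ε` is already bounded at order
      -- `ε ^ (-2)`.
      calc iterBound (shortStepParams L M ε) 2 Δ δ
          ≤ 2 * (1 / m * Δ * (1 / ε ^ 2)) + (b * (1 / ε)) * (k * S * (1 / ε)) := by
            unfold iterBound
            gcongr
            exact hB.trans (by gcongr)
        _ = (2 / m * Δ + b * k * S) * (1 / ε ^ 2) := by rw [hεε]; ring
        _ ≤ (2 / m * S + b * k * S) * (1 / ε ^ 2) := by gcongr; linarith
        _ = (2 / m + b * k) * S * (1 / ε ^ 2) := by ring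
        _ ≤ _ := by
            have h1 : 2 / m + b * k ≤ k + (2 / m + b * k) := le_add_of_nonneg_left hk0.le
            exact mul_le_mul_of_nonneg_right (mul_le_mul_of_nonneg_right h1 (by linarith))
              (by positivity)

end Constants


/-! ### Decrease in a single step. -/

section Steps

variable {d : ℕ} {f : Vec d → ℝ} {L M fbar : ℝ}

/-- The decrease in a step along an accurate gradient that is not small. -/
lemma IsObjective.apply_sub_smul_le (hf : IsObjective f L M fbar) (hL : 0 < L) {x g : Vec d}
    {e : ℝ} (he : 0 ≤ e) (hg : e < ‖g‖) (hacc : ‖g - gradient f x‖ ≤ 1 / 3 * max e ‖g‖) :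
    f (x - (1 / L) • g) ≤ f x - e ^ 2 / (6 * L) := by
  have h := hf.le_quadratic x (-((1 / L) • g))
  rw [← sub_eq_add_neg, inner_neg_right, norm_neg, norm_smul, real_inner_smul_right,
    Real.norm_of_nonneg (by positivity)] at h
  rw [max_eq_right hg.le] at hacc
  have h1 := real_inner_le_norm (g - gradient f x) g
  rw [inner_sub_left, real_inner_self_eq_norm_sq] at h1
  -- The relative error `1/3` leaves `2/3` of the slope; the quadratic term costs `1/2`, hence the
  -- final `1/6`.
  have h2 : 2 / 3 * ‖g‖ ^ 2 ≤ ⟪gradient f x, g⟫ := by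
    nlinarith [mul_le_mul_of_nonneg_right hacc (norm_nonneg g)]
  have h3 : 1 / L * (2 / 3 * ‖g‖ ^ 2) ≤ 1 / L * ⟪gradient f x, g⟫ := by gcongr
  have h4 : e ^ 2 / (6 * L) ≤ ‖g‖ ^ 2 / (6 * L) := by gcongr
  have h5 : L / 2 * (1 / L * ‖g‖) ^ 2 - 1 / L * (2 / 3 * ‖g‖ ^ 2) = -(‖g‖ ^ 2 / (6 * L)) := by
    field_simp
    ring
  linarith

/-- The decrease in a step along a direction of negative curvature, up to a term that changes
its sign with the direction. -/
lemma IsObjective.apply_add_smul_le (hf : IsObjective f L M fbar) (hM : 0 < M) {x p : Vec d}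
    {A : Op d} {h σ : ℝ} (hh : 0 ≤ h) (hp : ‖p‖ = 1) (hσ : σ = 1 ∨ σ = -1)
    (hcurv : ⟪p, A p⟫ < -h) (hacc : ‖A - hessian f x‖ ≤ 2 / 9 * h) :
    f (x + (2 * h / M * σ) • p) ≤
      f x - 2 * h ^ 3 / (9 * M ^ 2) + σ * (2 * h / M * ⟪gradient f x, p⟫) := by
  have hσ1 : |σ| = 1 := by rcases hσ with rfl | rfl <;> simp
  have key := hf.le_cubic x ((2 * h / M * σ) • p)
  have hnorm : ‖(2 * h / M * σ) • p‖ = 2 * h / M := by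
    rw [norm_smul, hp, Real.norm_eq_abs, abs_mul, hσ1, abs_of_nonneg (by positivity)]
    ring
  have hhess : ⟪hessian f x p, p⟫ ≤ -(7 / 9) * h := by
    have h1 := (abs_le.1 (abs_real_inner_le_norm p ((A - hessian f x) p))).1
    have h2 := (A - hessian f x).le_opNorm p
    rw [hp] at h1 h2
    rw [_root_.sub_apply, inner_sub_right, real_inner_comm (hessian f x p) p] at h1
    rw [_root_.sub_apply] at h2
    linarith
  -- Since `σ ^ 2 = 1`, the sign survives only in the linear term.
  have hquad : ⟪hessian f x ((2 * h / M * σ) • p), (2 * h / M * σ) • p⟫ ≤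
      (2 * h / M) ^ 2 * (-(7 / 9) * h) := by
    rw [map_smul, real_inner_smul_left, real_inner_smul_right, ← mul_assoc, ← sq, mul_pow,
      ← sq_abs σ, hσ1, one_pow, mul_one]
    gcongr
  rw [hnorm, real_inner_smul_right] at key
  -- In units of `h ^ 3 / M ^ 2`: `-14/9` from curvature at most `-(7/9) h`, and `12/9` from the
  -- cubic remainder.
  have h5 : 1 / 2 * ((2 * h / M) ^ 2 * (-(7 / 9) * h)) + M / 6 * (2 * h / M) ^ 3 =
      -(2 * h ^ 3 / (9 * M ^ 2)) := by
    field_simp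
    ring
  nlinarith

/-- Bounds the random fluctuation: negative curvature steps occur only where the approximate
gradient is small. -/
lemma abs_inner_le_of_accurate {v g p : Vec d} {e : ℝ} (hp : ‖p‖ = 1) (hg : ‖g‖ ≤ e)
    (hacc : ‖g - v‖ ≤ 1 / 3 * max e ‖g‖) : |⟪v, p⟫| ≤ 4 / 3 * e := by
  rw [max_eq_left hg] at hacc
  have h1 := abs_real_inner_le_norm v p
  have h2 := norm_sub_norm_le v g
  rw [norm_sub_rev] at h2
  rw [hp, mul_one] at h1
  linarith

end Steps

/-! ### Stopping time, measurability and the probability bound. -/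

section Run

variable {d : ℕ} {Ω : Type*} {f : Vec d → ℝ} {L M fbar ε : ℝ}

lemma exists_stopTime_eq_of_returns {π : Params} {R : RunData d Ω} {ω : Ω} {j : ℕ}
    (h : Returns π R j ω) : ∃ k : ℕ, stopTime π R ω = k ∧ k ≤ j := by
  have hle : stopTime π R ω ≤ (j : ℕ∞) := iInf₂_le j h
  obtain ⟨k, hk⟩ := ENat.ne_top_iff_exists.1 (ne_top_of_le_ne_top (ENat.natCast_ne_top j) hle)
  refine ⟨k, hk.symm, ?_⟩
  rw [← hk] at hle
  exact_mod_cast hle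

/-- Makes the accuracy assumptions, which hold only up to termination, available at every iteration
before `n`. -/
lemma le_stopTime {π : Params} {R : RunData d Ω} {ω : Ω} {n : ℕ}
    (h : ∀ j < n, ¬ Returns π R j ω) : (n : ℕ∞) ≤ stopTime π R ω := by
  refine le_iInf₂ fun k hk => ?_
  have : n ≤ k := not_lt.1 fun hkn => h k hkn hk
  exact_mod_cast this

open Classical in
/-- The slope of the objective along the random direction of a negative curvature step of
length `2 ε_H / M`; it is zero at other iterations. -/
noncomputable def curvSlope (π : Params) (R : RunData d Ω) (f : Vec d → ℝ) (x0 : Vec d) (k : ℕ)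
    (ω : Ω) : ℝ :=
  if NegCurvStep π R k ω then
    2 * π.epsH / π.M * ⟪gradient f (iterate π R x0 k ω), R.p k ω⟫
  else 0

section Measurability

variable [mΩ : MeasurableSpace Ω] {P : Measure Ω} {ℱ : Filtration ℕ mΩ} {R : RunData d Ω}

lemma IsRandomized.measurableSet_gradStep (hR : IsRandomized P ℱ R) (π : Params) (k : ℕ) :
    MeasurableSet[ℱ k] {ω | GradStep π R k ω} :=
  (hR.g_meas k).norm.measurable measurableSet_Ioi

lemma IsRandomized.measurableSet_negCurvStep (hR : IsRandomized P ℱ R) (π : Params) (k : ℕ) :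
    MeasurableSet[ℱ k] {ω | NegCurvStep π R k ω} := by
  have hl : StronglyMeasurable[ℱ k] (lambdaHat R k) :=
    (hR.p_meas k).inner (isBoundedBilinearMap_apply.continuous.comp_stronglyMeasurable
      ((hR.H_meas k).prodMk (hR.p_meas k)))
  exact (hR.measurableSet_gradStep π k).compl.inter (hl.measurable measurableSet_Iio)

lemma IsRandomized.stronglyMeasurable_iterate (hR : IsRandomized P ℱ R) (π : Params)
    (x0 : Vec d) (k : ℕ) : StronglyMeasurable[ℱ k] (iterate π R x0 k) := by
  induction k with
  | zero => exact stronglyMeasurable_const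
  | succ k ih =>
    have hle := ℱ.mono k.le_succ
    have ih' := ih.mono hle
    refine StronglyMeasurable.ite (hle _ (hR.measurableSet_gradStep π k))
      (ih'.sub (((hR.g_meas k).mono hle).const_smul (1 / π.L))) ?_
    refine StronglyMeasurable.ite (hle _ (hR.measurableSet_negCurvStep π k)) ?_ ih'
    refine ih'.add (StronglyMeasurable.smul (StronglyMeasurable.mul ?_ (hR.sign_meas k))
      ((hR.p_meas k).mono hle))
    simp only [div_eq_mul_inv]
    exact (((hR.stepSize_meas k).mono hle).const_mul 2).mul_const _

/-- The slope involves only `x_k` and data received at time `k`, so it is a predictable factor for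
`sign k`. -/
lemma IsRandomized.measurable_curvSlope (hR : IsRandomized P ℱ R)
    (hf : IsObjective f L M fbar) (π : Params) (x0 : Vec d) (k : ℕ) :
    Measurable[ℱ k] (curvSlope π R f x0 k) := by
  refine StronglyMeasurable.measurable ?_
  refine StronglyMeasurable.ite (hR.measurableSet_negCurvStep π k) ?_ stronglyMeasurable_const
  exact ((hf.continuous_gradient.comp_stronglyMeasurable
    (hR.stronglyMeasurable_iterate π x0 k)).inner (hR.p_meas k)).const_mul _

end Measurability

/-- One iteration before termination, compared with the increment of the exponent of the
exponential supermartingale. -/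
lemma theta_mul_decrease_le (hf : IsObjective f L M fbar) (hL : 0 < L) (hM : 0 < M) (hε : 0 < ε)
    {R : RunData d Ω} {x0 : Vec d} {ω : Ω} {k : ℕ} {θ D : ℝ}
    (hD : D = 2 * √(ε * M) ^ 3 / (9 * M ^ 2)) (hθ : θ = 1 / (144 * D))
    (hstep : R.stepSize k ω = √(ε * M)) (hsign : R.sign k ω = 1 ∨ R.sign k ω = -1)
    (hk : (k : ℕ∞) ≤ stopTime (shortStepParams L M ε) R ω)
    (hret : ¬ Returns (shortStepParams L M ε) R k ω)
    (hg : AccurateGradients (shortStepParams L M ε) R f x0 ω)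
    (hH : AccurateHessians (shortStepParams L M ε) R f x0 ω)
    (hp : AccurateEigenpairs (shortStepParams L M ε) R ω) :
    θ * (f (iterate (shortStepParams L M ε) R x0 (k + 1) ω) -
        f (iterate (shortStepParams L M ε) R x0 k ω)) ≤
      -(θ * constCeps (shortStepParams L M ε) / 2) +
        (R.sign k ω * (θ * curvSlope (shortStepParams L M ε) R f x0 k ω) -
          (θ * curvSlope (shortStepParams L M ε) R f x0 k ω) ^ 2 / 2) := by
  have hs : 0 < √(ε * M) := Real.sqrt_pos.2 (by positivity)
  have hD0 : 0 < D := by rw [hD]; positivity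
  have hθ0 : 0 < θ := by rw [hθ]; positivity
  have hC0 := constCeps_shortStepParams_pos hL hM hε
  have hCG : constCeps (shortStepParams L M ε) ≤ ε ^ 2 / (6 * L) := min_le_left _ _
  have hCD : constCeps (shortStepParams L M ε) ≤ D := hD ▸ min_le_right _ _
  have hgk := hg k hk
  by_cases hG : GradStep (shortStepParams L M ε) R k ω
  · have hN : ¬ NegCurvStep (shortStepParams L M ε) R k ω := fun h => h.1 hG
    have hdec := hf.apply_sub_smul_le hL hε.le hG hgk
    rw [iterate, if_pos hG, curvSlope, if_neg hN]
    simp only [shortStepParams] at hdec hCG hC0 ⊢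
    nlinarith
  · have hN : NegCurvStep (shortStepParams L M ε) R k ω := by
      by_contra hN
      exact hret ⟨hG, hN⟩
    have hpk := (hp k hk hG).1
    have hdec := hf.apply_add_smul_le hM hs.le hpk hsign hN.2 (hH k hk hG).2
    have habs := abs_inner_le_of_accurate hpk (not_lt.1 hG) hgk
    rw [iterate, if_neg hG, if_pos hN, curvSlope, if_pos hN, hstep]
    set b : ℝ := 2 * √(ε * M) / M *
      ⟪gradient f (iterate (shortStepParams L M ε) R x0 k ω), R.p k ω⟫ with hb
    rw [← hD] at hdec
    -- As `ε_H ^ 2 = ε M`, both sides equal a multiple of `ε_H ε / M`: `8/3` against `12 * 2/9`.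
    have hb12 : |b| ≤ 12 * D := by
      rw [hb, abs_mul, abs_of_pos (by positivity)]
      calc _ ≤ 2 * √(ε * M) / M * (4 / 3 * ε) := by gcongr; exact habs
        _ = 12 * D := by
          rw [hD, pow_succ, Real.sq_sqrt (by positivity)]
          field_simp
          norm_num
    have hb2 : b ^ 2 ≤ 144 * D ^ 2 := by
      calc b ^ 2 = |b| ^ 2 := (sq_abs b).symm
        _ ≤ (12 * D) ^ 2 := by gcongr
        _ = _ := by ring
    -- This dictates `θ`: the correction uses at most half of `θ D`, and the other half is at least
    -- `θ C_ε / 2`.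
    have hquad : (θ * b) ^ 2 / 2 ≤ θ * D / 2 := by
      calc (θ * b) ^ 2 / 2 = θ ^ 2 * b ^ 2 / 2 := by ring
        _ ≤ θ ^ 2 * (144 * D ^ 2) / 2 := by gcongr
        _ = θ * D / 2 := by rw [hθ]; field_simp
    have h1 := mul_le_mul_of_nonneg_left hdec hθ0.le
    have h2 := mul_le_mul_of_nonneg_left hCD hθ0.le
    change θ * (f (iterate (shortStepParams L M ε) R x0 k ω +
      (2 * √(ε * M) / M * R.sign k ω) • R.p k ω) - _) ≤
        _ + (R.sign k ω * (θ * b) - (θ * b) ^ 2 / 2)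
    linarith

/-- A run that does not return within the iteration bound forces a large exponent in the
exponential supermartingale. -/
lemma log_le_sum_of_not_returns (hf : IsObjective f L M fbar) (hL : 0 < L) (hM : 0 < M)
    (hε : 0 < ε) {R : RunData d Ω} {x0 : Vec d} {ω : Ω} {n : ℕ} {θ D δ : ℝ} (hδ : 0 < δ)
    (hδ1 : δ < 1)
    (hD : D = 2 * √(ε * M) ^ 3 / (9 * M ^ 2)) (hθ : θ = 1 / (144 * D))
    (hn : iterBound (shortStepParams L M ε) 2 (f x0 - fbar) δ ≤ n)
    (hstep : ∀ k, R.stepSize k ω = √(ε * M))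
    (hsign : ∀ k, R.sign k ω = 1 ∨ R.sign k ω = -1)
    (hret : ∀ j < n, ¬ Returns (shortStepParams L M ε) R j ω)
    (hg : AccurateGradients (shortStepParams L M ε) R f x0 ω)
    (hH : AccurateHessians (shortStepParams L M ε) R f x0 ω)
    (hp : AccurateEigenpairs (shortStepParams L M ε) R ω) :
    Real.log (1 / δ) ≤ ∑ k ∈ Finset.range n,
      (R.sign k ω * (θ * curvSlope (shortStepParams L M ε) R f x0 k ω) -
        (θ * curvSlope (shortStepParams L M ε) R f x0 k ω) ^ 2 / 2) := by
  have hs : 0 < √(ε * M) := Real.sqrt_pos.2 (by positivity)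
  have hD0 : 0 < D := by rw [hD]; positivity
  have hθ0 : 0 < θ := by rw [hθ]; positivity
  have hC0 := constCeps_shortStepParams_pos hL hM hε
  have hle_time := le_stopTime hret
  have hsum := Finset.sum_le_sum fun k (hk : k ∈ Finset.range n) =>
    theta_mul_decrease_le hf hL hM hε hD hθ (hstep k) (hsign k)
      ((Nat.cast_le.2 (Finset.mem_range.1 hk).le).trans hle_time) (hret k (Finset.mem_range.1 hk))
      hg hH hp
  rw [← Finset.mul_sum, Finset.sum_range_sub
    (fun k => f (iterate (shortStepParams L M ε) R x0 k ω)), Finset.sum_add_distrib,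
    Finset.sum_const, Finset.card_range, nsmul_eq_mul] at hsum
  have hlow : θ * (fbar - f x0) ≤
      θ * (f (iterate (shortStepParams L M ε) R x0 n ω) - f x0) := by
    gcongr
    exact hf.lower_bound _
  have h0 : iterate (shortStepParams L M ε) R x0 0 ω = x0 := rfl
  rw [h0] at hsum
  set C := constCeps (shortStepParams L M ε) with hC
  set B := constB (shortStepParams L M ε) with hB
  have hB0 : 0 < B := constB_shortStepParams_pos hL hM hε
  have hK := log_le_constK_shortStepParams (L := L) hM hε (f x0 - fbar) δ
  have hDCB : D ≤ 8 * C * B := hD ▸ curvDecrease_le_constCeps_mul_constB hL hM hε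
  have hlog : 0 ≤ Real.log (1 / δ) := Real.log_nonneg ((one_le_div hδ).2 hδ1.le)
  have hmain : θ * (f x0 - fbar) + Real.log (1 / δ) ≤ n * (θ * C / 2) := by
    -- Here `1152 = 8 * 144`; it is also half of the `2304` in the logarithmic entry of `K`.
    have hCB : 1 ≤ 1152 * (θ * C * B) := by
      have h1 := mul_le_mul_of_nonneg_left hDCB hθ0.le
      have h2 : θ * D = 1 / 144 := by rw [hθ]; field_simp
      linarith [show θ * (8 * C * B) = 8 * (θ * C * B) by ring]
    have hKB : Real.log (1 / δ) ≤ θ * C / 2 * (B * constK (shortStepParams L M ε) 2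
        (f x0 - fbar) δ) := by
      calc Real.log (1 / δ) = 1 * Real.log (1 / δ) := (one_mul _).symm
        _ ≤ 1152 * (θ * C * B) * Real.log (1 / δ) := by gcongr
        _ = θ * C / 2 * (B * (2304 * Real.log (1 / δ))) := by ring
        _ ≤ _ := by gcongr
    calc θ * (f x0 - fbar) + Real.log (1 / δ)
        ≤ θ * C / 2 * (2 * ((f x0 - fbar) / C)) + θ * C / 2 *
            (B * constK (shortStepParams L M ε) 2 (f x0 - fbar) δ) := by
          refine add_le_add (le_of_eq ?_) hKB
          field_simp
      _ = θ * C / 2 * iterBound (shortStepParams L M ε) 2 (f x0 - fbar) δ := by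
          rw [iterBound, mul_add]
      _ ≤ θ * C / 2 * n := by gcongr
      _ = n * (θ * C / 2) := mul_comm _ _
  linarith

lemma IsRandomized.ae_sign [mΩ : MeasurableSpace Ω] {P : Measure Ω} [IsProbabilityMeasure P]
    {ℱ : Filtration ℕ mΩ} {R : RunData d Ω} (hR : IsRandomized P ℱ R) :
    ∀ᵐ ω ∂P, ∀ k, R.sign k ω = 1 ∨ R.sign k ω = -1 :=
  ae_all_iff.2 fun k => ae_eq_one_or_eq_neg_one ((hR.sign_meas k).measurable.mono (ℱ.le _) le_rfl)
    (hR.sign_one k) (hR.sign_neg_one k)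

/-- With probability at least `1 - δ`, the algorithm with short negative curvature steps returns
within the iteration bound. -/
theorem one_sub_le_prob_stopTime_lt (hL : 0 < L) (hM : 0 < M) (hε : 0 < ε) {δ : ℝ} (hδ : 0 < δ)
    (hδ1 : δ < 1) {x0 : Vec d} (hf : IsObjective f L M fbar) [mΩ : MeasurableSpace Ω]
    (P : Measure Ω) [IsProbabilityMeasure P] (ℱ : Filtration ℕ mΩ) (R : RunData d Ω)
    (hstep : ∀ k ω, R.stepSize k ω = √(ε * M)) (hR : IsRandomized P ℱ R)
    (hg : ∀ᵐ ω ∂P, AccurateGradients (shortStepParams L M ε) R f x0 ω)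
    (hH : ∀ᵐ ω ∂P, AccurateHessians (shortStepParams L M ε) R f x0 ω)
    (hp : ∀ᵐ ω ∂P, AccurateEigenpairs (shortStepParams L M ε) R ω) :
    1 - δ ≤ P.real {ω | ∃ k : ℕ, stopTime (shortStepParams L M ε) R ω = (k : ℕ∞) ∧
      (k : ℝ) < iterBound (shortStepParams L M ε) 2 (f x0 - fbar) δ} := by
  set n := ⌈iterBound (shortStepParams L M ε) 2 (f x0 - fbar) δ⌉₊ with hn
  set D : ℝ := 2 * √(ε * M) ^ 3 / (9 * M ^ 2) with hD
  set θ : ℝ := 1 / (144 * D) with hθ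
  set Z : Ω → ℝ := fun ω => ∑ k ∈ Finset.range n,
      (R.sign k ω * (θ * curvSlope (shortStepParams L M ε) R f x0 k ω) -
        (θ * curvSlope (shortStepParams L M ε) R f x0 k ω) ^ 2 / 2) with hZ
  have hu : ∀ k, Measurable[ℱ k]
      fun ω => θ * curvSlope (shortStepParams L M ε) R f x0 k ω := fun k =>
    (hR.measurable_curvSlope hf _ x0 k).const_mul θ
  have hint : ∫⁻ ω, ENNReal.ofReal (Real.exp (Z ω)) ∂P ≤ 1 :=
    lintegral_exp_sum_coin_le_one P ℱ hR.sign_meas hR.sign_one hR.sign_neg_one hR.sign_indep hu n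
  have hZm : Measurable Z := by
    refine Finset.measurable_fun_sum _ fun k _ => ?_
    have hsk := (hR.sign_meas k).measurable.mono (ℱ.le _) le_rfl
    have huk := (hu k).mono (ℱ.le _) le_rfl
    exact (hsk.mul huk).sub ((huk.pow_const 2).div_const 2)
  have hbad : P {ω | Real.log (1 / δ) ≤ Z ω} ≤ ENNReal.ofReal δ := by
    -- Markov's inequality for `exp Z` at level `1 / δ`.
    have hmarkov := mul_meas_ge_le_lintegral (μ := P) (hZm.exp.ennreal_ofReal)
      (ENNReal.ofReal (1 / δ))
    have hsub : {ω | Real.log (1 / δ) ≤ Z ω} ⊆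
        {ω | ENNReal.ofReal (1 / δ) ≤ ENNReal.ofReal (Real.exp (Z ω))} := fun ω hω =>
      ENNReal.ofReal_le_ofReal ((Real.log_le_iff_le_exp (by positivity)).1 hω)
    calc P {ω | Real.log (1 / δ) ≤ Z ω}
        = ENNReal.ofReal δ * (ENNReal.ofReal (1 / δ) * P {ω | Real.log (1 / δ) ≤ Z ω}) := by
          rw [← mul_assoc, ← ENNReal.ofReal_mul hδ.le, mul_one_div_cancel hδ.ne',
            ENNReal.ofReal_one, one_mul]
      _ ≤ ENNReal.ofReal δ * 1 := by
          gcongr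
          exact ((mul_le_mul_right (measure_mono hsub) _).trans hmarkov).trans hint
      _ = ENNReal.ofReal δ := mul_one _
  have hbad' : P.real {ω | Real.log (1 / δ) ≤ Z ω} ≤ δ :=
    ENNReal.toReal_le_of_le_ofReal hδ.le hbad
  have hcompl := probReal_compl_eq_one_sub (μ := P) (measurableSet_le measurable_const hZm :
    MeasurableSet {ω | Real.log (1 / δ) ≤ Z ω})
  refine (by rw [hcompl]; linarith : 1 - δ ≤ P.real {ω | Real.log (1 / δ) ≤ Z ω}ᶜ).trans ?_
  refine ENNReal.toReal_mono (measure_ne_top _ _) (measure_mono_ae ?_)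
  filter_upwards [hg, hH, hp, hR.ae_sign] with ω hgω hHω hpω hsω hgood
  by_contra hcon
  refine hgood (log_le_sum_of_not_returns hf hL hM hε hδ hδ1 hD hθ (Nat.le_ceil _)
    (fun k => hstep k ω) hsω (fun j hj hret => hcon ?_) hgω hHω hpω)
  obtain ⟨k, hk, hkj⟩ := exists_stopTime_eq_of_returns hret
  -- Because `n` is a ceiling, `k < n` is equivalent to the strict real bound.
  exact ⟨k, hk, Nat.lt_ceil.1 (hkj.trans_lt hj)⟩

lemma admissibleSteps_shortStepParams {R : RunData d Ω}
    (hstep : ∀ k ω, R.stepSize k ω = √(ε * M)) (hL : √(ε * M) ≤ L) :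
    AdmissibleSteps (shortStepParams L M ε) R := by
  refine ⟨⟨le_rfl, hL⟩, fun k ω h => ?_⟩
  rw [hstep]
  refine ⟨le_rfl, le_min le_rfl ?_⟩
  have h2 : lambdaHat R k ω < -√(ε * M) := h.2
  exact (by linarith : √(ε * M) ≤ -lambdaHat R k ω).trans (neg_le_abs _)

end Run

end RandNC

theorem mainTheorem3 (L M : ℝ) (hL : 0 < L) (hM : 0 < M) :
    -- growth of the constants as functions of `ε`, with `η = 2`
    (∃ c : ℝ, 0 < c ∧ ∀ ε : ℝ, 0 < ε → ε ≤ 1 →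
      |RandNC.constC (RandNC.shortStepParams L M ε)| ≤ c ∧
      |RandNC.constB (RandNC.shortStepParams L M ε)| ≤ c * (1 / ε ^ (1 / 2 : ℝ)) ∧
      ∀ Δ δ : ℝ, 0 ≤ Δ → 0 < δ → δ < 1 →
        |RandNC.constK (RandNC.shortStepParams L M ε) 2 Δ δ|
          ≤ c * (1 + Δ + Real.log (1 / δ)) * (1 / ε) ∧
        |RandNC.iterBound (RandNC.shortStepParams L M ε) 2 Δ δ|
          ≤ c * (1 + Δ + Real.log (1 / δ)) * (1 / ε ^ 2)) ∧
    -- the algorithm with `α_k = ε_H` for all `k`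
    (∀ (ε δ : ℝ), 0 < ε → 0 < δ → δ < 1 →
      ∀ (d : ℕ) (f : RandNC.Vec d → ℝ) (fbar : ℝ) (x0 : RandNC.Vec d),
      RandNC.IsObjective f L M fbar →
      ∀ (Ω : Type*) [mΩ : MeasurableSpace Ω] (P : MeasureTheory.Measure Ω)
        [MeasureTheory.IsProbabilityMeasure P]
        (ℱ : MeasureTheory.Filtration ℕ mΩ) (R : RandNC.RunData d Ω),
      (∀ k ω, R.stepSize k ω = √(ε * M)) →
      RandNC.IsRandomized P ℱ R →
      (∀ᵐ ω ∂P, RandNC.AccurateGradients (RandNC.shortStepParams L M ε) R f x0 ω) →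
      (∀ᵐ ω ∂P, RandNC.AccurateHessians (RandNC.shortStepParams L M ε) R f x0 ω) →
      (∀ᵐ ω ∂P, RandNC.AccurateEigenpairs (RandNC.shortStepParams L M ε) R ω) →
        (√(ε * M) ≤ L → RandNC.AdmissibleSteps (RandNC.shortStepParams L M ε) R) ∧
        1 - δ ≤ P.real {ω | ∃ k : ℕ,
          RandNC.stopTime (RandNC.shortStepParams L M ε) R ω = (k : ℕ∞) ∧
          (k : ℝ) < RandNC.iterBound (RandNC.shortStepParams L M ε) 2 (f x0 - fbar) δ}) := by
  refine ⟨RandNC.exists_constants_bound hL hM, ?_⟩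
  intro ε δ hε hδ hδ1 d f fbar x0 hf Ω mΩ P _ ℱ R hstep hR hg hH hp
  exact ⟨RandNC.admissibleSteps_shortStepParams hstep,
    RandNC.one_sub_le_prob_stopTime_lt hL hM hε hδ hδ1 hf P ℱ R hstep hR hg hH hp⟩
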